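/- **Theorem.** Let $n\ge 1$ and let $U\subset\mathbb{R}^n$ be a bounded open set with Lipschitz boundary: for every $x\in\partial U$ there are an orthogonal change of coordinates (rotation and relabelling of the axes), an $r>0$ and a Lipschitz function $\gamma:\mathbb{R}^{n-1}\to\mathbb{R}$ such that, in these coordinates, $$U\cap Q(x,r)=\{y: y_n>\gamma(y_1,\dots,y_{n-1})\}\cap Q(x,r),\qquad Q(x,r)=\{y:|y_i-x_i|\le r,\ i=1,\dots,n\}.$$ Then $\partial U$ admits a regular Lipschitz deformation. That is, there exists a map $\Psi:\partial U\times[0,1]\to\overline{U}$, written $\Psi_\tau(x)=\Psi(x,\tau)$, such that 1. $\Psi$ is a bi-Lipschitz homeomorphism from $\partial U\times[0,1]$ onto its image, and $\Psi_0$ is the identity of $\partial U$; 2. for every $\tau\in(0,1]$, the set $\partial U_\tau:=\Psi_\tau(\partial U)$ is the boundary of an open set $U_\tau\subset U$; 3. for every $\tau\in(0,1]$, the tangential Jacobian $$J^{\partial U}\Psi_\tau=\sqrt{\det\big((d^{\partial U}\Psi_\tau)^{T}\,d^{\partial U}\Psi_\tau\big)},$$ where $d^{\partial U}\Psi_\tau(x)$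 is the differential of $\Psi_\tau$ along the tangent space of $\partial U$ at $x$, is defined $\mathcal{H}^{n-1}$-almost everywhere on $\partial U$ and is integrable, and $$\lim_{\tau\to0^+}J^{\partial U}\Psi_\tau=1\qquad\text{in }L^1(\partial U;\mathcal{H}^{n-1}).$$ -/

import Mathlib

open MeasureTheory Set Filter Topology
open scoped NNReal

/-- Condition (i) of a deformable Lipschitz boundary: near every boundary point `x` of `Ω ⊆ ℝⁿ⁺¹`,
in the coordinates given by some orthogonal change of axes `R` (rotation and relabelling), the set
`Ω` is, inside the closed cube of half-side `r` centred at `x`, the region strictly above the graph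
of a Lipschitz function `γ : ℝⁿ → ℝ`. -/
def HasLipschitzBoundary {n : ℕ} (Ω : Set (EuclideanSpace ℝ (Fin (n + 1)))) : Prop :=
  ∀ x ∈ frontier Ω,
    ∃ (R : EuclideanSpace ℝ (Fin (n + 1)) ≃ₗᵢ[ℝ] EuclideanSpace ℝ (Fin (n + 1)))
      (r : ℝ) (γ : EuclideanSpace ℝ (Fin n) → ℝ),
      0 < r ∧ (∃ K : ℝ≥0, LipschitzWith K γ) ∧
      ∀ y : EuclideanSpace ℝ (Fin (n + 1)),
        (∀ i, |R y i - R x i| ≤ r) →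
          (y ∈ Ω ↔ γ (WithLp.toLp 2 fun i : Fin n => R y i.castSucc) < R y (Fin.last n))

/-- A Lipschitz deformation `Ψ : ∂Ω × [0,1] → closure Ω` of `∂Ω`: it is bi-Lipschitz onto its image,
it starts at the identity, and for every `τ ∈ (0,1]` the image `∂Ω_τ = Ψ(∂Ω × {τ})` is the
boundary of an open subset `Ω_τ` of `Ω`. The values of `Ψ` off `∂Ω × [0,1]` are irrelevant. -/
structure IsLipschitzDeformation {n : ℕ} (Ω : Set (EuclideanSpace ℝ (Fin (n + 1))))
    (Ψ : EuclideanSpace ℝ (Fin (n + 1)) × ℝ → EuclideanSpace ℝ (Fin (n + 1))) : Prop where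
  mapsTo : MapsTo Ψ (frontier Ω ×ˢ Icc (0 : ℝ) 1) (closure Ω)
  lipschitz : ∃ K : ℝ≥0, LipschitzOnWith K Ψ (frontier Ω ×ˢ Icc (0 : ℝ) 1)
  antilipschitz : ∃ K : ℝ≥0, AntilipschitzWith K ((frontier Ω ×ˢ Icc (0 : ℝ) 1).domRestrict Ψ)
  initial : ∀ x ∈ frontier Ω, Ψ (x, 0) = x
  exists_domain : ∀ τ ∈ Ioc (0 : ℝ) 1, ∃ Ωτ : Set (EuclideanSpace ℝ (Fin (n + 1))),
    IsOpen Ωτ ∧ Ωτ ⊆ Ω ∧ frontier Ωτ = (fun x => Ψ (x, τ)) '' frontier Ω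

/-- The tangent space of a set `S` at `x`: the span of the tangent cone (formed by the limits of
`c_k (y_k - x)` with `y_k ∈ S`, `y_k → x`, `c_k ∈ ℝ`). If `S` is a Lipschitz hypersurface, this is
the usual tangent hyperplane at every point where the local graph function is differentiable, hence
at almost every point of `S`. -/
noncomputable def tangentSpaceOf {n : ℕ} (S : Set (EuclideanSpace ℝ (Fin n)))
    (x : EuclideanSpace ℝ (Fin n)) : Submodule ℝ (EuclideanSpace ℝ (Fin n)) :=
  Submodule.span ℝ (tangentConeAt ℝ S x)

/-- The tangential differential of `f` along `S` at `x`: the derivative of `f` at `x` within `S`,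
restricted to the tangent space. If `f` is differentiable at `x` within `S`, this restriction does
not depend on the derivative chosen. -/
noncomputable def tangentialDeriv {n : ℕ} (S : Set (EuclideanSpace ℝ (Fin n)))
    (f : EuclideanSpace ℝ (Fin n) → EuclideanSpace ℝ (Fin n)) (x : EuclideanSpace ℝ (Fin n)) :
    tangentSpaceOf S x →ₗ[ℝ] EuclideanSpace ℝ (Fin n) :=
  (fderivWithin ℝ f S x).toLinearMap.domRestrict (tangentSpaceOf S x)

/-- The tangential Jacobian `J^S f (x) = √ det (Lᵀ L)`, where `L` is the tangential differential
of `f` along `S` at `x`. -/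
noncomputable def tangentialJacobian {n : ℕ} (S : Set (EuclideanSpace ℝ (Fin n)))
    (f : EuclideanSpace ℝ (Fin n) → EuclideanSpace ℝ (Fin n)) (x : EuclideanSpace ℝ (Fin n)) : ℝ :=
  Real.sqrt (LinearMap.det
    ((LinearMap.adjoint (tangentialDeriv S f x)) ∘ₗ (tangentialDeriv S f x)))

/-- The Hausdorff measure `H^{n}` (normalised as usual) on `∂Ω`, for `Ω ⊆ ℝⁿ⁺¹`. -/
noncomputable def surfaceMeasure {n : ℕ} (Ω : Set (EuclideanSpace ℝ (Fin (n + 1)))) :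
    Measure (EuclideanSpace ℝ (Fin (n + 1))) :=
  (Measure.euclideanHausdorffMeasure n).restrict (frontier Ω)

/-- A regular Lipschitz deformation: the tangential Jacobians `J^{∂Ω} Ψ_τ` are defined almost
everywhere and integrable on `∂Ω`, and they converge to `1` in `L¹(∂Ω; H^{n})` as `τ → 0⁺`. -/
structure IsRegularLipschitzDeformation {n : ℕ} (Ω : Set (EuclideanSpace ℝ (Fin (n + 1))))
    (Ψ : EuclideanSpace ℝ (Fin (n + 1)) × ℝ → EuclideanSpace ℝ (Fin (n + 1))) : Prop
    extends IsLipschitzDeformation Ω Ψ where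
  differentiable : ∀ τ ∈ Ioc (0 : ℝ) 1, ∀ᵐ x ∂surfaceMeasure Ω,
    DifferentiableWithinAt ℝ (fun x => Ψ (x, τ)) (frontier Ω) x
  integrable : ∀ τ ∈ Ioc (0 : ℝ) 1,
    Integrable (tangentialJacobian (frontier Ω) fun x => Ψ (x, τ)) (surfaceMeasure Ω)
  tendsto_one : Tendsto
    (fun τ : ℝ => eLpNorm
      (fun x => tangentialJacobian (frontier Ω) (fun x => Ψ (x, τ)) x - 1) 1 (surfaceMeasure Ω))
    (𝓝[>] 0) (𝓝 0)

/-! The deformation is `Ψ (x, τ) = x + (ε * τ) • W x`, with `W` a compactly supported `C¹` field on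
the whole space that points into `U` along the boundary, and `ε` small.

In a Lipschitz chart the upward vertical direction is inward at all nearby boundary points, even
after small perturbations of base point and direction. The inward directions at a point form a
convex set, so a partition of unity glues these local constants into `W`, and compactness of the
boundary makes the inwardness uniform with one `δ`.

Uniform inwardness gives the geometry. No boundary point can be reached from another, nearby one by
a short step in a direction close to `W`, since it would lie in the open set `U`; hence `Ψ`
separates both points and times linearly (`exists_sub_le_mul_norm_of_inward`). For small `t > 0` the
map `x ↦ x + t • W x` is a homeomorphism of the space carrying `U` into itself, so the image of `U`
is the domain sought and its frontier is the image of the frontier.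

The derivative of `Ψ_τ` is within `ε * τ * L` of the identity, `L` being a Lipschitz constant of
`W`, so the tangential Jacobian tends to `1` uniformly. As the surface measure is finite, `L¹`
convergence follows once the Jacobian is measurable, which amounts to measurable dependence of the
tangent space on the point. -/

/-! ### Uniformly inward directions. -/

section InwardDirections

variable {E : Type*} [NormedAddCommGroup E] [NormedSpace ℝ E]

/-- The directions `v` pointing uniformly into `U` at `x`: starting at any point of `closure U`
close to `x`, a short step in a direction close to `v` ends in `U`. -/
def inwardDirections (U : Set E) (x : E) : Set E :=
  {v | ∀ᶠ p : E × E × ℝ in 𝓝[closure U] x ×ˢ 𝓝 v ×ˢ 𝓝[>] (0 : ℝ), p.1 + p.2.2 • p.2.1 ∈ U}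

/-- A step `t` along a direction `w` near `a • v₁ + b • v₂` splits into a step `a * t` along `v₁ +
(w - v)` followed by a step `b * t` along `v₂ + (w - v)`. The first ends in `U`, still close to `x`,
so the second may start there. -/
theorem convex_inwardDirections (U : Set E) (x : E) : Convex ℝ (inwardDirections U x) := by
  intro v₁ h₁ v₂ h₂ a b ha hb hab
  rcases ha.eq_or_lt with rfl | ha
  · obtain rfl : b = 1 := by linarith
    simpa using h₂
  rcases hb.eq_or_lt with rfl | hb
  · obtain rfl : a = 1 := by linarith
    simpa using h₁
  simp only [inwardDirections, mem_ofPred_eq] at h₁ h₂ ⊢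
  set v := a • v₁ + b • v₂ with hv
  set l : Filter (E × E × ℝ) := 𝓝[closure U] x ×ˢ 𝓝 v ×ˢ 𝓝[>] (0 : ℝ) with hl
  have t₁ : Tendsto (fun p : E × E × ℝ => p.1) l (𝓝[closure U] x) := tendsto_fst
  have t₂ : Tendsto (fun p : E × E × ℝ => p.2.1) l (𝓝 v) := tendsto_fst.comp tendsto_snd
  have t₃ : Tendsto (fun p : E × E × ℝ => p.2.2) l (𝓝[>] 0) := tendsto_snd.comp tendsto_snd
  have scale : ∀ c : ℝ, 0 < c → Tendsto (fun p : E × E × ℝ => c * p.2.2) l (𝓝[>] 0) := by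
    intro c hc
    rw [tendsto_nhdsWithin_iff] at t₃ ⊢
    refine ⟨by simpa using t₃.1.const_mul c, t₃.2.mono fun p hp => ?_⟩
    exact mul_pos hc hp
  have shift : ∀ u : E, Tendsto (fun p : E × E × ℝ => u + (p.2.1 - v)) l (𝓝 u) := by
    intro u
    simpa using tendsto_const_nhds.add (t₂.sub_const v)
  have e₁ := (t₁.prodMk ((shift v₁).prodMk (scale a ha))).eventually h₁
  have mid : Tendsto (fun p : E × E × ℝ => p.1 + (a * p.2.2) • (v₁ + (p.2.1 - v))) l
      (𝓝[closure U] x) := by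
    rw [tendsto_nhdsWithin_iff]
    refine ⟨?_, e₁.mono fun p hp => subset_closure hp⟩
    simpa using (t₁.mono_right nhdsWithin_le_nhds).add
      (((scale a ha).mono_right nhdsWithin_le_nhds).smul (shift v₁))
  refine ((mid.prodMk ((shift v₂).prodMk (scale b hb))).eventually h₂).mono fun p hp => ?_
  convert hp using 1
  have : p.2.1 = a • (v₁ + (p.2.1 - v)) + b • (v₂ + (p.2.1 - v)) := by
    have h : a • (v₁ + (p.2.1 - v)) + b • (v₂ + (p.2.1 - v))
        = v + ((a + b) • p.2.1 - (a + b) • v) := by rw [hv]; module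
    rw [h, hab]; simp
  nth_rewrite 1 [this]
  module

/-- A field of inward directions along a compact set, continuous there, is uniformly inward. -/
theorem exists_uniform_inward {U S : Set E} (hS : IsCompact S) {V : E → E}
    (hV : Continuous V) (h : ∀ x ∈ S, V x ∈ inwardDirections U x) :
    ∃ δ > 0, ∀ x ∈ S, ∀ z ∈ closure U, ‖z - x‖ < δ → ∀ w, ‖w - V x‖ < δ →
      ∀ t ∈ Ioc (0 : ℝ) δ, z + t • w ∈ U := by
  refine hS.induction_on (p := fun S => ∃ δ > 0, ∀ x ∈ S, ∀ z ∈ closure U, ‖z - x‖ < δ →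
    ∀ w, ‖w - V x‖ < δ → ∀ t ∈ Ioc (0 : ℝ) δ, z + t • w ∈ U) ⟨1, one_pos, by simp⟩ ?_ ?_ ?_
  · rintro s t hst ⟨δ, hδ, H⟩
    exact ⟨δ, hδ, fun x hx => H x (hst hx)⟩
  · rintro s t ⟨δ, hδ, H⟩ ⟨δ', hδ', H'⟩
    refine ⟨min δ δ', lt_min hδ hδ', ?_⟩
    rintro x (hx | hx) z hz hzx w hw τ hτ
    · exact H x hx z hz (hzx.trans_le (min_le_left _ _)) w (hw.trans_le (min_le_left _ _)) τ
        ⟨hτ.1, hτ.2.trans (min_le_left _ _)⟩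
    · exact H' x hx z hz (hzx.trans_le (min_le_right _ _)) w (hw.trans_le (min_le_right _ _)) τ
        ⟨hτ.1, hτ.2.trans (min_le_right _ _)⟩
  · intro x hx
    have hx := h x hx
    simp only [inwardDirections, mem_ofPred_eq] at hx
    rw [((nhdsWithin_hasBasis Metric.nhds_basis_ball _).prod
      (Metric.nhds_basis_ball.prod (nhdsGT_basis (0 : ℝ)))).eventually_iff] at hx
    obtain ⟨⟨a, b, c⟩, ⟨ha, hb, hc⟩, H⟩ := hx
    simp only at ha hb hc H
    have hVx : ∀ᶠ y in 𝓝 x, dist (V y) (V x) < b / 2 :=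
      Metric.tendsto_nhds.1 hV.continuousAt _ (by positivity)
    have hyx : ∀ᶠ y in 𝓝 x, dist y x < a / 2 := Metric.ball_mem_nhds x (by positivity)
    refine ⟨_, mem_nhdsWithin_of_mem_nhds (hVx.and hyx), min (a / 2) (min (b / 2) (c / 2)),
      by positivity, ?_⟩
    rintro y ⟨hy₁, hy₂⟩ z hz hzy w hw t ⟨ht₀, ht⟩
    simp only [lt_min_iff, le_min_iff] at hzy hw ht
    refine @H (z, w, t) ⟨⟨?_, hz⟩, ?_, ht₀, by simp only; linarith⟩
    · rw [Metric.mem_ball]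
      calc dist z x ≤ dist z y + dist y x := dist_triangle _ _ _
        _ < a := by rw [dist_eq_norm z y]; linarith
    · rw [Metric.mem_ball]
      calc dist w (V x) ≤ dist w (V y) + dist (V y) (V x) := dist_triangle _ _ _
        _ < b := by rw [dist_eq_norm w]; linarith

end InwardDirections

/-! ### Lipschitz charts and the inward vector field. -/

section Graph

variable {n : ℕ}

theorem eventually_abs_apply_sub_lt
    (R : EuclideanSpace ℝ (Fin (n + 1)) ≃ₗᵢ[ℝ] EuclideanSpace ℝ (Fin (n + 1)))
    (x : EuclideanSpace ℝ (Fin (n + 1))) {r : ℝ} (hr : 0 < r) :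
    ∀ᶠ y in 𝓝 x, ∀ i, |R y i - R x i| < r := by
  rw [eventually_all]
  intro i
  have : Continuous fun y => |R y i - R x i| := by fun_prop
  have h0 : Tendsto (fun y => |R y i - R x i|) (𝓝 x) (𝓝 0) := by
    simpa using this.tendsto x
  exact h0.eventually_lt_const hr

/-- The first `n` coordinates of a vector. -/
noncomputable def dropLast : EuclideanSpace ℝ (Fin (n + 1)) →L[ℝ] EuclideanSpace ℝ (Fin n) :=
  LinearMap.toContinuousLinearMap
    { toFun := fun y => WithLp.toLp 2 fun i : Fin n => y i.castSucc
      map_add' := fun _ _ => rfl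
      map_smul' := fun _ _ => rfl }

theorem dropLast_apply (y : EuclideanSpace ℝ (Fin (n + 1))) :
    dropLast y = WithLp.toLp 2 fun i : Fin n => y i.castSucc := rfl

theorem graph_le_of_mem_closure {U : Set (EuclideanSpace ℝ (Fin (n + 1)))}
    {R : EuclideanSpace ℝ (Fin (n + 1)) ≃ₗᵢ[ℝ] EuclideanSpace ℝ (Fin (n + 1))}
    {x : EuclideanSpace ℝ (Fin (n + 1))} {r : ℝ} {γ : EuclideanSpace ℝ (Fin n) → ℝ}
    (hγ : Continuous γ)
    (h : ∀ y, (∀ i, |R y i - R x i| ≤ r) → (y ∈ U ↔ γ (dropLast (R y)) < R y (Fin.last n)))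
    {y : EuclideanSpace ℝ (Fin (n + 1))} (hy : y ∈ closure U) (hyr : ∀ i, |R y i - R x i| < r) :
    γ (dropLast (R y)) ≤ R y (Fin.last n) := by
  by_contra! hlt
  have c₁ : Continuous fun y => R y (Fin.last n) := by fun_prop
  have c₂ : Continuous fun y => γ (dropLast (R y)) := by fun_prop
  have hbox : ∀ᶠ z in 𝓝 y, ∀ i, |R z i - R x i| < r := by
    rw [eventually_all]
    intro i
    have : Continuous fun y => |R y i - R x i| := by fun_prop
    exact this.continuousAt.eventually_lt_const (hyr i)
  have hlt' : ∀ᶠ z in 𝓝 y, R z (Fin.last n) < γ (dropLast (R z)) :=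
    c₁.continuousAt.eventually_lt c₂.continuousAt hlt
  obtain ⟨z, hzU, hz₁, hz₂⟩ :=
    ((mem_closure_iff_frequently.1 hy).and_eventually (hbox.and hlt')).exists
  exact lt_asymm ((h z fun i => (hz₁ i).le).1 hzU) hz₂

/-- The vertical direction of a Lipschitz chart is inward at all boundary points near its centre. -/
theorem HasLipschitzBoundary.exists_inward {U : Set (EuclideanSpace ℝ (Fin (n + 1)))}
    (hU : HasLipschitzBoundary U) {x : EuclideanSpace ℝ (Fin (n + 1))} (hx : x ∈ frontier U) :
    ∃ c, ∀ᶠ y in 𝓝 x, c ∈ inwardDirections U y := by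
  obtain ⟨R, r, γ, hr, ⟨K, hK⟩, h⟩ := hU x hx
  change ∀ y, (∀ i, |R y i - R x i| ≤ r) → (y ∈ U ↔ γ (dropLast (R y)) < R y (Fin.last n)) at h
  refine ⟨R.symm (EuclideanSpace.single (Fin.last n) 1), ?_⟩
  set e := R.symm (EuclideanSpace.single (Fin.last n) (1 : ℝ)) with he
  filter_upwards [eventually_abs_apply_sub_lt R x hr] with y hy
  simp only [inwardDirections, mem_ofPred_eq]
  set l : Filter (EuclideanSpace ℝ (Fin (n + 1)) × EuclideanSpace ℝ (Fin (n + 1)) × ℝ) :=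
    𝓝[closure U] y ×ˢ 𝓝 e ×ˢ 𝓝[>] (0 : ℝ) with hl
  have hl' : l ≤ 𝓝 (y, e, 0) := by
    rw [nhds_prod_eq, nhds_prod_eq]
    exact Filter.prod_mono nhdsWithin_le_nhds (Filter.prod_mono le_rfl nhdsWithin_le_nhds)
  have h₁ : ∀ᶠ p in l, p.1 ∈ closure U :=
    tendsto_fst.eventually (eventually_mem_nhdsWithin (a := y) (s := closure U))
  have h₂ : ∀ᶠ p in l, 0 < p.2.2 :=
    (tendsto_snd.comp tendsto_snd).eventually (eventually_mem_nhdsWithin (a := (0 : ℝ)) (s := Ioi 0))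
  have h₃ : ∀ᶠ p in l, ∀ i, |R p.1 i - R x i| < r := by
    rw [eventually_all]
    intro i
    have : Continuous fun p : EuclideanSpace ℝ (Fin (n + 1)) × EuclideanSpace ℝ (Fin (n + 1)) × ℝ =>
      |R p.1 i - R x i| := by fun_prop
    exact hl' (this.continuousAt.eventually_lt_const (hy i))
  have h₄ : ∀ᶠ p in l, ∀ i, |R (p.1 + p.2.2 • p.2.1) i - R x i| < r := by
    rw [eventually_all]
    intro i
    have : Continuous fun p : EuclideanSpace ℝ (Fin (n + 1)) × EuclideanSpace ℝ (Fin (n + 1)) × ℝ =>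
      |R (p.1 + p.2.2 • p.2.1) i - R x i| := by fun_prop
    refine hl' (this.continuousAt.eventually_lt_const ?_)
    simpa using hy i
  -- The open cone condition: directions steeper than `K` leave the graph upwards. It holds at `e`,
  -- whose horizontal part vanishes, hence nearby.
  have h₅ : ∀ᶠ p in l, K * ‖dropLast (R p.2.1)‖ < R p.2.1 (Fin.last n) := by
    have c₁ : Continuous fun p : EuclideanSpace ℝ (Fin (n + 1)) ×
      EuclideanSpace ℝ (Fin (n + 1)) × ℝ => K * ‖dropLast (R p.2.1)‖ := by fun_prop
    have c₂ : Continuous fun p : EuclideanSpace ℝ (Fin (n + 1)) ×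
      EuclideanSpace ℝ (Fin (n + 1)) × ℝ => R p.2.1 (Fin.last n) := by fun_prop
    refine hl' (c₁.continuousAt.eventually_lt c₂.continuousAt ?_)
    have : dropLast (EuclideanSpace.single (Fin.last n) (1 : ℝ)) = 0 := by
      ext i
      simp [dropLast_apply, Fin.castSucc_ne_last]
    simp [he, this]
  filter_upwards [h₁, h₂, h₃, h₄, h₅] with p p₁ p₂ p₃ p₄ p₅
  rw [h _ fun i => (p₄ i).le]
  have g := graph_le_of_mem_closure hK.continuous h p₁ p₃
  have k := (le_abs_self _).trans (hK.dist_le_mul (dropLast (R (p.1 + p.2.2 • p.2.1)))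
    (dropLast (R p.1)))
  rw [dist_eq_norm] at k
  simp only [map_add, map_smul, add_sub_cancel_left, norm_smul, Real.norm_eq_abs, abs_of_pos p₂]
    at k ⊢
  have : p.2.2 * (K * ‖dropLast (R p.2.1)‖) < p.2.2 * R p.2.1 (Fin.last n) :=
    mul_lt_mul_of_pos_left p₅ p₂
  simp only [PiLp.add_apply, PiLp.smul_apply, smul_eq_mul]
  linarith

open scoped Manifold ContDiff in
/-- A bounded set with Lipschitz boundary has a smooth, compactly supported vector field that points
inward along the boundary. -/
theorem HasLipschitzBoundary.exists_vectorField {U : Set (EuclideanSpace ℝ (Fin (n + 1)))}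
    (hb : Bornology.IsBounded U) (hU : HasLipschitzBoundary U) :
    ∃ W : EuclideanSpace ℝ (Fin (n + 1)) → EuclideanSpace ℝ (Fin (n + 1)),
      ContDiff ℝ 1 W ∧ HasCompactSupport W ∧ ∀ x ∈ frontier U, W x ∈ inwardDirections U x := by
  classical
  obtain ⟨V, hV⟩ := exists_contMDiffMap_forall_mem_convex_of_local_const (n := 1)
    (𝓘(ℝ, EuclideanSpace ℝ (Fin (n + 1))))
    -- Off the frontier nothing is required, so the constant `0` serves there.
    (t := fun x => {v | x ∈ frontier U → v ∈ inwardDirections U x})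
    (fun x => by
      by_cases hx : x ∈ frontier U
      · simpa [hx] using convex_inwardDirections U x
      · simpa [hx] using convex_univ)
    (fun x => by
      by_cases hx : x ∈ frontier U
      · obtain ⟨c, hc⟩ := hU.exists_inward hx
        exact ⟨c, hc.mono fun y hy _ => hy⟩
      · refine ⟨0, ?_⟩
        filter_upwards [isClosed_frontier.isOpen_compl.mem_nhds hx] with y hy hy'
        exact absurd hy' hy)
  obtain ⟨ρ, hρ, hUρ⟩ := hb.closure.subset_closedBall_lt 0 0
  -- The cutoff equals `1` on a ball containing `closure U`; compact support will make the field
  -- bounded and globally Lipschitz.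
  let χ : ContDiffBump (0 : EuclideanSpace ℝ (Fin (n + 1))) := ⟨ρ, ρ + 1, hρ, by linarith⟩
  refine ⟨fun x => χ x • V x, χ.contDiff.smul V.contMDiff.contDiff,
    χ.hasCompactSupport.smul_right, fun x hx => ?_⟩
  change χ x • V x ∈ _
  rw [χ.one_of_mem_closedBall (hUρ (frontier_subset_closure hx)), one_smul]
  exact hV x hx

end Graph

/-! ### Displacement along an inward field. -/

section Displacement

variable {E : Type*} [NormedAddCommGroup E] [NormedSpace ℝ E]

/-- A small Lipschitz displacement of the identity is a homeomorphism. -/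
theorem exists_homeomorph_add_smul [CompleteSpace E] {W : E → E} {L : ℝ≥0} (hW : LipschitzWith L W)
    {t : ℝ} (ht₀ : 0 ≤ t) (ht : t * L < 1) : ∃ Φ : E ≃ₜ E, ∀ x, Φ x = x + t • W x := by
  lift t to ℝ≥0 using ht₀
  have hA : ApproximatesLinearOn (fun x => x + (t : ℝ) • W x)
      ((ContinuousLinearEquiv.refl ℝ E : E ≃L[ℝ] E) : E →L[ℝ] E) univ (t * L) := by
    intro x _ y _
    have h := hW.dist_le_mul x y
    rw [dist_eq_norm, dist_eq_norm] at h
    have e : x + (t : ℝ) • W x - (y + (t : ℝ) • W y) -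
        ((ContinuousLinearEquiv.refl ℝ E : E ≃L[ℝ] E) : E →L[ℝ] E) (x - y) = (t : ℝ) • (W x - W y) := by
      simp only [ContinuousLinearEquiv.coe_refl, ContinuousLinearMap.coe_id', id_eq]
      module
    rw [e, norm_smul, Real.norm_of_nonneg t.coe_nonneg, NNReal.coe_mul, mul_assoc]
    exact mul_le_mul_of_nonneg_left h t.coe_nonneg
  refine ⟨hA.toHomeomorph _ ?_, fun x => rfl⟩
  -- The inverse of the identity has norm `1` only in a nontrivial space.
  rcases subsingleton_or_nontrivial E with h | h
  · exact Or.inl h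
  · refine Or.inr ?_
    have hN : ‖(((ContinuousLinearEquiv.refl ℝ E).symm : E ≃L[ℝ] E) : E →L[ℝ] E)‖₊ = 1 := by
      ext
      simp
    rw [hN, inv_one]
    exact_mod_cast ht

variable {U : Set E} {W : E → E} {δ : ℝ}

/-- A point closer than `δ / (L + 1)` to the frontier sees a field value within `δ` of an inward
one, so it moves into `U`. Any other point of `U` is the centre of a ball of that radius contained
in `U`, by connectedness, and the displacement is too short to leave it. -/
theorem mapsTo_add_smul_of_inward (hδ : 0 < δ)
    (h : ∀ x ∈ frontier U, ∀ z ∈ closure U, ‖z - x‖ < δ → ∀ w, ‖w - W x‖ < δ →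
      ∀ t ∈ Ioc (0 : ℝ) δ, z + t • w ∈ U)
    {L : ℝ≥0} (hW : LipschitzWith L W) {M : ℝ} (hM : ∀ x, ‖W x‖ ≤ M) {t : ℝ} (ht : t ∈ Ioc 0 δ)
    (htM : t * M * (L + 1) < δ) : MapsTo (fun x => x + t • W x) U U := by
  intro z hz
  by_cases hne : ∃ x ∈ frontier U, ‖z - x‖ * (L + 1) < δ
  · obtain ⟨x, hx, hzx⟩ := hne
    have hl := hW.dist_le_mul z x
    rw [dist_eq_norm, dist_eq_norm] at hl
    have h₀ := norm_nonneg (z - x)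
    have hL : (0 : ℝ) ≤ L := L.2
    exact h x hx z (subset_closure hz) (by nlinarith) _ (by nlinarith) t ht
  · push Not at hne
    by_contra hzU
    have hball : IsPreconnected (Metric.ball z (δ / (L + 1))) :=
      (convex_ball z _).isPreconnected
    have hL : (0 : ℝ) < L + 1 := by positivity
    have hfr : (Metric.ball z (δ / (L + 1)) ∩ frontier U).Nonempty := by
      by_contra hemp
      have hd : Disjoint (Metric.ball z (δ / (L + 1))) (frontier U) :=
        disjoint_iff_inter_eq_empty.2 (not_nonempty_iff_eq_empty.1 hemp)
      have hsub : Metric.ball z (δ / (L + 1)) ⊆ U := by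
        refine fun y hy => ?_
        by_contra hyU
        rcases isPreconnected_iff_subset_of_disjoint.1 hball (interior U)
          (interior Uᶜ) isOpen_interior isOpen_interior
          (fun p hp => by
            have : p ∉ frontier U := fun hpf => hd.ne_of_mem hp hpf rfl
            rw [frontier_eq_closure_inter_closure, mem_inter_iff, not_and_or] at this
            rcases this with h | h
            · exact Or.inr (by rwa [interior_compl])
            · exact Or.inl (by rwa [closure_compl, notMem_compl_iff] at h))
          (by
            rw [eq_empty_iff_forall_notMem]
            rintro p ⟨-, hp₁, hp₂⟩
            exact interior_subset hp₂ (interior_subset hp₁)) with hs | hs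
        · exact hyU (interior_subset (hs hy))
        · exact interior_subset (hs (Metric.mem_ball_self (by positivity))) hz
      refine hzU (hsub ?_)
      rw [Metric.mem_ball, dist_eq_norm, add_sub_cancel_left, norm_smul,
        Real.norm_of_nonneg ht.1.le, lt_div_iff₀ hL]
      have := hM z
      have := ht.1
      calc t * ‖W z‖ * (L + 1) ≤ t * M * (L + 1) := by gcongr
        _ < δ := htM
    obtain ⟨x, hx, hxf⟩ := hfr
    have := hne x hxf
    rw [Metric.mem_ball, dist_comm, dist_eq_norm, lt_div_iff₀ hL] at hx
    linarith

/-- If the bound failed, `x = y + d • w` with `w` within `δ` of `W y`. Then `x` (for `d > 0`) or `y`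
(for `d < 0`, stepping back from `x`) would lie in the open set `U`, which misses its frontier. -/
theorem le_norm_sub_sub_smul_of_inward (hU : IsOpen U) (hδ : 0 < δ)
    (h : ∀ x ∈ frontier U, ∀ z ∈ closure U, ‖z - x‖ < δ → ∀ w, ‖w - W x‖ < δ →
      ∀ t ∈ Ioc (0 : ℝ) δ, z + t • w ∈ U)
    {x y : E} (hx : x ∈ frontier U) (hy : y ∈ frontier U) (hxy : ‖x - y‖ < δ) {d : ℝ}
    (hd : |d| ≤ δ) : δ * |d| ≤ ‖x - y - d • W y‖ := by
  have hnot : ∀ z ∈ frontier U, z ∉ U := fun z hz hzU => by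
    rw [hU.frontier_eq] at hz
    exact hz.2 hzU
  by_contra! hlt
  rcases lt_trichotomy d 0 with hneg | rfl | hpos
  · rw [abs_of_neg hneg] at hlt hd
    refine hnot y hy ?_
    have := h y hy x (frontier_subset_closure hx) hxy (W y + d⁻¹ • (x - y - d • W y)) (by
      rw [add_sub_cancel_left, norm_smul, norm_inv, Real.norm_eq_abs, abs_of_neg hneg,
        inv_mul_lt_iff₀ (by linarith)]
      linarith) (-d) ⟨by linarith, hd⟩
    convert this using 1
    rw [smul_add, smul_smul, neg_mul, mul_inv_cancel₀ hneg.ne]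
    module
  · simp at hlt
    exact absurd hlt (norm_nonneg _).not_gt
  · rw [abs_of_pos hpos] at hlt hd
    refine hnot x hx ?_
    have := h y hy y (frontier_subset_closure hy) (by simpa) (W y + d⁻¹ • (x - y - d • W y)) (by
      rw [add_sub_cancel_left, norm_smul, norm_inv, Real.norm_eq_abs, abs_of_pos hpos,
        inv_mul_lt_iff₀ hpos]
      linarith) d ⟨hpos, hd⟩
    convert this using 1
    rw [smul_add, smul_smul, mul_inv_cancel₀ hpos.ne']
    module

/-- Displacing boundary points along an inward field by different amounts separates them, at a rate
that is linear both in the distance of the points and in the difference of the amounts. -/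
theorem exists_sub_le_mul_norm_of_inward (hU : IsOpen U) (hδ : 0 < δ)
    (h : ∀ x ∈ frontier U, ∀ z ∈ closure U, ‖z - x‖ < δ → ∀ w, ‖w - W x‖ < δ →
      ∀ t ∈ Ioc (0 : ℝ) δ, z + t • w ∈ U)
    {L : ℝ≥0} (hW : LipschitzWith L W) {M : ℝ} (hM : ∀ x, ‖W x‖ ≤ M) {ε : ℝ} (hε : ε ≤ δ)
    (hεL : 2 * (ε * L * (δ + M)) ≤ δ) (hεM : 4 * (ε * M) ≤ δ) :
    ∃ K : ℝ, ∀ x ∈ frontier U, ∀ y ∈ frontier U, ∀ s ∈ Icc 0 ε, ∀ t ∈ Icc 0 ε,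
      ‖x - y‖ ≤ K * ‖x + s • W x - (y + t • W y)‖ ∧
        |s - t| ≤ K * ‖x + s • W x - (y + t • W y)‖ := by
  -- The three summands bound, in order, the distance for near points, the time difference for near
  -- points, and both for far points.
  refine ⟨2 * (δ + M) / δ + 2 / δ + 2 , fun x hx y hy s hs t ht => ?_⟩
  have hM₀ : 0 ≤ M := (norm_nonneg _).trans (hM x)
  have hst : |t - s| ≤ ε := abs_sub_le_iff.2 ⟨by linarith [hs.1, ht.2], by linarith [hs.2, ht.1]⟩
  rw [abs_sub_comm s t]
  set N := ‖x + s • W x - (y + t • W y)‖ with hN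
  have hN₀ : 0 ≤ N := norm_nonneg _
  set D := ‖x - y‖ with hD
  have hD₀ : 0 ≤ D := norm_nonneg _
  have e : (2 * (δ + M) / δ + 2 / δ + 2) * N = 2 * (δ + M) * N / δ + 2 * N / δ + 2 * N := by ring
  have p₁ : 0 ≤ 2 * (δ + M) * N / δ := by positivity
  have p₂ : 0 ≤ 2 * N / δ := by positivity
  rw [e]
  rcases lt_or_ge D δ with hnear | hfar
  · set A := ‖x - y - (t - s) • W y‖ with hA
    have a₁ : δ * |t - s| ≤ A := le_norm_sub_sub_smul_of_inward hU hδ h hx hy hnear (hst.trans hε)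
    have a₂ : D ≤ A + M * |t - s| := by
      have : x - y = (x - y - (t - s) • W y) + (t - s) • W y := by abel
      calc D ≤ A + ‖(t - s) • W y‖ := by rw [hD, hA]; nth_rewrite 1 [this]; exact norm_add_le _ _
        _ ≤ A + M * |t - s| := by
          rw [norm_smul, Real.norm_eq_abs, mul_comm]
          gcongr
          exact hM y
    -- Replacing `W x` by `W y` costs `ε * L * D`, which `hεL` makes at most `A / 2`, so it is
    -- absorbed.
    have a₃ : A ≤ N + ε * (L * D) := by
      have : x - y - (t - s) • W y = (x + s • W x - (y + t • W y)) - s • (W x - W y) := by module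
      calc A ≤ N + ‖s • (W x - W y)‖ := by rw [hA, this]; exact norm_sub_le _ _
        _ ≤ N + ε * (L * D) := by
          rw [norm_smul, Real.norm_of_nonneg hs.1, ← dist_eq_norm (W x)]
          have := hW.dist_le_mul x y
          rw [dist_eq_norm x y] at this
          have := mul_le_mul hs.2 this dist_nonneg (hs.1.trans hs.2)
          linarith
    have a₄ : δ * D ≤ (δ + M) * A := by nlinarith
    have a₅ : 2 * (ε * (L * D)) ≤ A := by
      have q : 2 * (ε * L * (δ + M)) * D ≤ (δ + M) * A :=
        (mul_le_mul_of_nonneg_right hεL hD₀).trans a₄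
      have : (δ + M) * (2 * (ε * (L * D))) ≤ (δ + M) * A := by linarith
      exact le_of_mul_le_mul_left this (by linarith)
    have a₆ : A ≤ 2 * N := by linarith
    have b₁ : D ≤ 2 * (δ + M) * N / δ := by
      rw [le_div_iff₀ hδ]
      nlinarith
    have b₂ : |t - s| ≤ 2 * N / δ := by
      rw [le_div_iff₀ hδ]
      linarith
    exact ⟨by linarith, by linarith⟩
  -- Far points: the two displacements total at most `δ / 2 ≤ D / 2`, and `|t - s| ≤ ε ≤ δ ≤ D`.
  · have c₁ : D ≤ N + 2 * (ε * M) := by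
      have : x - y = (x + s • W x - (y + t • W y)) - s • W x + t • W y := by module
      have n₁ : ‖s • W x‖ ≤ ε * M := by
        rw [norm_smul, Real.norm_of_nonneg hs.1]
        exact mul_le_mul hs.2 (hM x) (norm_nonneg _) (hs.1.trans hs.2)
      have n₂ : ‖t • W y‖ ≤ ε * M := by
        rw [norm_smul, Real.norm_of_nonneg ht.1]
        exact mul_le_mul ht.2 (hM y) (norm_nonneg _) (ht.1.trans ht.2)
      calc D ≤ N + ‖s • W x‖ + ‖t • W y‖ := by
            rw [hD, this]
            exact (norm_add_le _ _).trans (add_le_add_left (norm_sub_le _ _) _)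
        _ ≤ N + 2 * (ε * M) := by linarith
    have c₂ : D ≤ 2 * N := by linarith
    have c₃ : |t - s| ≤ 2 * N := by linarith
    exact ⟨by linarith, by linarith⟩

end Displacement

/-! ### Bounds and a formula for Gram determinants. -/

section Determinant

open scoped InnerProductSpace

/-- In an orthonormal eigenbasis of `TᵀT` the eigenvalues are `‖T eᵢ‖ ^ 2`, so the root is `∏ ‖T
eᵢ‖`. Since `1 - c ≤ 1 ≤ 1 + c`, the exponent may exceed the dimension, which need not be known. -/
theorem sqrt_det_adjoint_comp_self_mem_Icc {F G : Type*} [NormedAddCommGroup F]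
    [InnerProductSpace ℝ F] [FiniteDimensional ℝ F] [NormedAddCommGroup G] [InnerProductSpace ℝ G]
    [FiniteDimensional ℝ G] (T : F →ₗ[ℝ] G) {c : ℝ} (hc₀ : 0 ≤ c) (hc₁ : c ≤ 1)
    (hlow : ∀ v, (1 - c) * ‖v‖ ≤ ‖T v‖) (hup : ∀ v, ‖T v‖ ≤ (1 + c) * ‖v‖) {k : ℕ}
    (hk : Module.finrank ℝ F ≤ k) :
    √(LinearMap.det (LinearMap.adjoint T ∘ₗ T)) ∈ Icc ((1 - c) ^ k) ((1 + c) ^ k) := by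
  have hT := T.isSymmetric_adjoint_comp_self
  have hev : ∀ i, hT.eigenvalues rfl i = ‖T (hT.eigenvectorBasis rfl i)‖ ^ 2 := by
    intro i
    have h := hT.apply_eigenvectorBasis rfl i
    have h' := congrArg (fun v => ⟪hT.eigenvectorBasis rfl i, v⟫_ℝ) h
    simp only [LinearMap.comp_apply, LinearMap.adjoint_inner_right] at h'
    rw [real_inner_self_eq_norm_sq] at h'
    rw [h']
    simp [real_inner_smul_right]
  have hsqrt : √(LinearMap.det (LinearMap.adjoint T ∘ₗ T)) =
      ∏ i, ‖T (hT.eigenvectorBasis rfl i)‖ := by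
    rw [hT.det_eq_prod_eigenvalues rfl]
    simp only [hev, RCLike.ofReal_real_eq_id, id_eq]
    rw [Finset.prod_pow, Real.sqrt_sq (Finset.prod_nonneg fun i _ => norm_nonneg _)]
  have hl : ∀ i, 1 - c ≤ ‖T (hT.eigenvectorBasis rfl i)‖ := fun i => by
    simpa using hlow (hT.eigenvectorBasis rfl i)
  have hu : ∀ i, ‖T (hT.eigenvectorBasis rfl i)‖ ≤ 1 + c := fun i => by
    simpa using hup (hT.eigenvectorBasis rfl i)
  rw [hsqrt]
  constructor
  · calc (1 - c) ^ k ≤ (1 - c) ^ Module.finrank ℝ F :=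
          pow_le_pow_of_le_one (by linarith) (by linarith) hk
      _ = ∏ i : Fin (Module.finrank ℝ F), (1 - c) := by simp
      _ ≤ _ := Finset.prod_le_prod (fun _ _ => by linarith) fun i _ => hl i
  · calc _ ≤ ∏ i : Fin (Module.finrank ℝ F), (1 + c) :=
          Finset.prod_le_prod (fun _ _ => norm_nonneg _) fun i _ => hu i
      _ = (1 + c) ^ Module.finrank ℝ F := by simp
      _ ≤ (1 + c) ^ k := pow_le_pow_right₀ (by linarith) hk

/-- The **Weinstein–Aronszajn identity** for linear maps. -/
theorem LinearMap.det_one_add_comp_comm {F G : Type*} [AddCommGroup F] [Module ℝ F]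
    [FiniteDimensional ℝ F] [AddCommGroup G] [Module ℝ G] [FiniteDimensional ℝ G]
    (f : F →ₗ[ℝ] G) (g : G →ₗ[ℝ] F) :
    LinearMap.det (LinearMap.id + g ∘ₗ f) = LinearMap.det (LinearMap.id + f ∘ₗ g) := by
  classical
  let b := Module.finBasis ℝ F
  let c := Module.finBasis ℝ G
  rw [← LinearMap.det_toMatrix b, ← LinearMap.det_toMatrix c, map_add, map_add,
    LinearMap.toMatrix_comp b c b, LinearMap.toMatrix_comp c b c, LinearMap.toMatrix_id,
    LinearMap.toMatrix_id, Matrix.det_one_add_mul_comm]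

/-- Moves a determinant on the varying space `T` to the fixed space `E`: on `T` the operator is `1 +
P (AᵀA - 1) ι`, with `ι` the inclusion and `P` the projection, and swapping the factors leaves a
matrix that depends on `T` only through the projections of basis vectors. -/
theorem det_adjoint_comp_domRestrict {E ι : Type*} [NormedAddCommGroup E] [InnerProductSpace ℝ E]
    [FiniteDimensional ℝ E] [Fintype ι] [DecidableEq ι] (b : OrthonormalBasis ι ℝ E)
    (T : Submodule ℝ E) (A : E →ₗ[ℝ] E) :
    LinearMap.det (LinearMap.adjoint (A.domRestrict T) ∘ₗ A.domRestrict T) =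
      (Matrix.of fun i j => ⟪b i, b j⟫_ℝ + (⟪A (T.starProjection (b i)), A (b j)⟫_ℝ -
        ⟪T.starProjection (b i), b j⟫_ℝ)).det := by
  set g : E →ₗ[ℝ] T := T.orthogonalProjectionOnto.toLinearMap ∘ₗ
    (LinearMap.adjoint A ∘ₗ A - LinearMap.id) with hg
  have h : LinearMap.adjoint (A.domRestrict T) ∘ₗ A.domRestrict T =
      LinearMap.id + g ∘ₗ T.subtype := by
    ext1 v
    refine ext_inner_left ℝ fun w => ?_
    have hp : ⟪w, g v⟫_ℝ = ⟪(w : E), LinearMap.adjoint A (A v) - v⟫_ℝ :=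
      Submodule.inner_orthogonalProjectionOnto_eq_of_mem_left w _
    rw [LinearMap.comp_apply, LinearMap.adjoint_inner_right, LinearMap.add_apply,
      LinearMap.id_apply, inner_add_right, LinearMap.comp_apply, Submodule.subtype_apply, hp,
      inner_sub_right, LinearMap.adjoint_inner_right, Submodule.coe_inner,
      LinearMap.domRestrict_apply, LinearMap.domRestrict_apply]
    ring
  rw [h, LinearMap.det_one_add_comp_comm, ← LinearMap.det_toMatrix b.toBasis]
  congr 1
  ext i j
  have hs : ∀ v, T.subtype (g v) = T.starProjection (LinearMap.adjoint A (A v) - v) := fun v => rfl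
  rw [LinearMap.toMatrix_apply, b.coe_toBasis, b.coe_toBasis_repr_apply, b.repr_apply_apply,
    LinearMap.add_apply, LinearMap.comp_apply, hs, inner_add_right,
    ← Submodule.inner_starProjection_left_eq_right, inner_sub_right, LinearMap.adjoint_inner_right,
    LinearMap.id_apply, Matrix.of_apply]

end Determinant

/-! ### The tangential Jacobian of a map close to the identity. -/

section TangentialJacobian

variable {n : ℕ} {S : Set (EuclideanSpace ℝ (Fin n))}
  {f : EuclideanSpace ℝ (Fin n) → EuclideanSpace ℝ (Fin n)} {x : EuclideanSpace ℝ (Fin n)}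

/-- Two derivatives within `S` agree on the tangent cone, hence on its span, so unique
differentiability is not needed. -/
theorem tangentialDeriv_eq {f' : EuclideanSpace ℝ (Fin n) →L[ℝ] EuclideanSpace ℝ (Fin n)}
    (hf : HasFDerivWithinAt f f' S x) :
    tangentialDeriv S f x = f'.toLinearMap.domRestrict (tangentSpaceOf S x) := by
  have h := hf.differentiableWithinAt.hasFDerivWithinAt.unique_on hf
  ext1 v
  exact LinearMap.eqOn_span' (f := (fderivWithin ℝ f S x).toLinearMap) (g := f'.toLinearMap) h v.2

theorem tangentialJacobian_mem_Icc
    {A : EuclideanSpace ℝ (Fin n) →L[ℝ] EuclideanSpace ℝ (Fin n)}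
    (hf : HasFDerivWithinAt f (ContinuousLinearMap.id ℝ _ + A) S x) {c : ℝ} (hA : ‖A‖ ≤ c)
    (hc : c ≤ 1) : tangentialJacobian S f x ∈ Icc ((1 - c) ^ n) ((1 + c) ^ n) := by
  have hAv : ∀ v, ‖A v‖ ≤ c * ‖v‖ := fun v => A.le_of_opNorm_le hA v
  rw [tangentialJacobian, tangentialDeriv_eq hf]
  refine sqrt_det_adjoint_comp_self_mem_Icc _ ((norm_nonneg _).trans hA) hc ?_ ?_ ?_
  · intro v
    have h₁ := norm_sub_norm_le (v : EuclideanSpace ℝ (Fin n)) (-A v)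
    rw [norm_neg, sub_neg_eq_add] at h₁
    have h₂ := hAv v
    change (1 - c) * ‖(v : EuclideanSpace ℝ (Fin n))‖ ≤ ‖(v : EuclideanSpace ℝ (Fin n)) + A v‖
    linarith
  · intro v
    have h₁ := norm_add_le (v : EuclideanSpace ℝ (Fin n)) (A v)
    have h₂ := hAv v
    change ‖(v : EuclideanSpace ℝ (Fin n)) + A v‖ ≤ (1 + c) * ‖(v : EuclideanSpace ℝ (Fin n))‖
    linarith
  · simpa using Submodule.finrank_le (tangentSpaceOf S x)

end TangentialJacobian

/-! ### Measurable dependence of the tangent space on the point. -/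

section TangentMeasurability

open scoped InnerProductSpace

variable {E : Type*} [NormedAddCommGroup E]

/-- Turns the limit into countably many closed conditions, the form needed for Borel measurability.
-/
theorem mem_tangentConeAt_iff_forall_nat [NormedSpace ℝ E] {S : Set E} {x v : E} :
    v ∈ tangentConeAt ℝ S x ↔ ∀ k : ℕ, ∃ y ∈ S, ∃ c : ℝ, ‖y - x‖ ≤ 1 / ((k : ℝ) + 1) ∧
      ‖c • (y - x) - v‖ ≤ 1 / ((k : ℝ) + 1) := by
  rw [mem_tangentConeAt_iff_exists_seq]
  constructor
  · rintro ⟨c, d, hd, hS, hcd⟩ k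
    have hk : (0 : ℝ) < 1 / ((k : ℝ) + 1) := by positivity
    obtain ⟨m, h₁, h₂, h₃⟩ := (hS.and ((Metric.tendsto_nhds.1 hd _ hk).and
      (Metric.tendsto_nhds.1 hcd _ hk))).exists
    rw [dist_eq_norm] at h₂ h₃
    exact ⟨x + d m, h₁, c m, by simpa using h₂.le, by simpa using h₃.le⟩
  · intro h
    choose y hy c h₁ h₂ using h
    refine ⟨c, fun k => y k - x, ?_, Eventually.of_forall fun k => by simpa using hy k, ?_⟩
    · exact squeeze_zero_norm h₁ tendsto_one_div_add_atTop_nhds_zero_nat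
    · rw [tendsto_iff_norm_sub_tendsto_zero]
      exact squeeze_zero (fun _ => norm_nonneg _) h₂ tendsto_one_div_add_atTop_nhds_zero_nat

/-- For a compact set `S`, the points at which some tuple of tangent directions lies in a given
compact set form a Borel set. -/
theorem measurableSet_exists_mem_tangentConeAt [NormedSpace ℝ E] [MeasurableSpace E] [BorelSpace E]
    {S : Set E} (hS : IsCompact S) {N : ℕ} {K : Set (Fin N → E)} (hK : IsCompact K) :
    MeasurableSet {x : S | ∃ v ∈ K, ∀ i, v i ∈ tangentConeAt ℝ S (x : E)} := by
  have : CompactSpace S := isCompact_iff_compactSpace.1 hS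
  let A : ℕ → ℕ → Set (S × (Fin N → S) × (Fin N → ℝ) × (Fin N → E)) := fun k m =>
    (univ ×ˢ univ ×ˢ (univ.pi fun _ => Icc (-m : ℝ) m) ×ˢ K) ∩
      ⋂ i, {p | ‖((p.2.1 i : E)) - p.1‖ ≤ 1 / ((k : ℝ) + 1)} ∩
        {p | ‖p.2.2.1 i • ((p.2.1 i : E) - p.1) - p.2.2.2 i‖ ≤ 1 / ((k : ℝ) + 1)}
  have hA : ∀ k m, IsCompact (A k m) := fun k m => by
    refine IsCompact.inter_right (isCompact_univ.prod (isCompact_univ.prod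
      ((isCompact_univ_pi fun _ => isCompact_Icc).prod hK))) (isClosed_iInter fun i => ?_)
    exact (isClosed_le (by fun_prop) continuous_const).inter
      (isClosed_le (by fun_prop) continuous_const)
  -- Bounding the scalars by `m` makes each `A k m` compact, so its projection is closed.
  have hset : {x : S | ∃ v ∈ K, ∀ i, v i ∈ tangentConeAt ℝ S (x : E)} =
      ⋂ k, ⋃ m, Prod.fst '' A k m := by
    ext x
    simp only [mem_ofPred_eq, mem_iInter, mem_iUnion]
    constructor
    · rintro ⟨v, hv, h⟩ k
      have h := fun i => mem_tangentConeAt_iff_forall_nat.1 (h i) k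
      choose y hy c h₁ h₂ using h
      obtain ⟨m, hm⟩ := exists_nat_ge ‖c‖
      refine ⟨m, ⟨x, fun i => ⟨y i, hy i⟩, c, v⟩, ⟨⟨trivial, trivial, fun i _ => ?_, hv⟩, ?_⟩, rfl⟩
      · exact abs_le.1 ((norm_le_pi_norm c i).trans hm)
      · exact mem_iInter.2 fun i => ⟨h₁ i, h₂ i⟩
    · intro h
      choose m p hp hpx using h
      have hpK : ∀ k, (p k).2.2.2 ∈ K := fun k => (hp k).1.2.2.2
      have hp₁ : ∀ k i, ‖((p k).2.1 i : E) - x‖ ≤ 1 / ((k : ℝ) + 1) := fun k i => by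
        have := (mem_iInter.1 (hp k).2 i).1
        rwa [mem_ofPred_eq, hpx k] at this
      have hp₂ : ∀ k i, ‖(p k).2.2.1 i • (((p k).2.1 i : E) - x) - (p k).2.2.2 i‖ ≤
          1 / ((k : ℝ) + 1) := fun k i => by
        have := (mem_iInter.1 (hp k).2 i).2
        rwa [mem_ofPred_eq, hpx k] at this
      -- The tuple found depends on `k`; compactness of `K` supplies a single limit tuple.
      obtain ⟨v, hv, φ, hφ, hlim⟩ := hK.tendsto_subseq hpK
      have h0 : Tendsto (fun j => 1 / ((φ j : ℝ) + 1)) atTop (𝓝 0) :=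
        tendsto_one_div_add_atTop_nhds_zero_nat.comp hφ.tendsto_atTop
      refine ⟨v, hv, fun i => mem_tangentConeAt_of_seq atTop (fun j => (p (φ j)).2.2.1 i)
        (fun j => ((p (φ j)).2.1 i : E) - x) (squeeze_zero_norm (fun j => hp₁ _ i) h0)
        (by simp) ?_⟩
      have hd : Tendsto (fun j => (p (φ j)).2.2.1 i • (((p (φ j)).2.1 i : E) - x) -
          (p (φ j)).2.2.2 i) atTop (𝓝 0) := squeeze_zero_norm (fun j => hp₂ _ i) h0
      simpa using hd.add ((continuous_apply i).continuousAt.tendsto.comp hlim)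
  rw [hset]
  exact MeasurableSet.iInter fun k => MeasurableSet.iUnion fun m =>
    ((hA k m).image continuous_fst).isClosed.measurableSet

variable [InnerProductSpace ℝ E] [FiniteDimensional ℝ E] [MeasurableSpace E] [BorelSpace E]

/-- The norm is the distance to the span, attained at the projection. The tangent cone is stable
under scalars, so elements of the span are finite sums of cone vectors; exhausting by their number
and size reduces sublevel sets to the compact case. -/
theorem measurable_norm_sub_starProjection_tangentSpan {S : Set E} (hS : IsCompact S) (w : E) :
    Measurable fun x : S =>
      ‖w - (Submodule.span ℝ (tangentConeAt ℝ S (x : E))).starProjection w‖ := by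
  have hprop : ProperSpace E := FiniteDimensional.proper ℝ E
  refine measurable_of_Iic fun r => ?_
  have hset : (fun x : S =>
      ‖w - (Submodule.span ℝ (tangentConeAt ℝ S (x : E))).starProjection w‖) ⁻¹' Iic r =
      ⋃ N : ℕ, ⋃ m : ℕ, {x : S | ∃ v ∈ Metric.closedBall (0 : Fin N → E) m ∩
        {v | ‖w - ∑ i, v i‖ ≤ r}, ∀ i, v i ∈ tangentConeAt ℝ S (x : E)} := by
    ext x
    simp only [mem_preimage, mem_Iic, mem_iUnion, mem_ofPred_eq]
    constructor
    · intro h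
      obtain ⟨N, a, g, hg⟩ := Submodule.mem_span_set'.1
        ((Submodule.span ℝ (tangentConeAt ℝ S (x : E))).starProjection_apply_mem w)
      obtain ⟨m, hm⟩ := exists_nat_ge ‖fun i => a i • (g i : E)‖
      refine ⟨N, m, fun i => a i • (g i : E), ⟨by simpa using hm, ?_⟩, fun i => ?_⟩
      · rw [mem_ofPred_eq, hg]
        exact h
      · obtain ⟨c, d, h₁, h₂, h₃⟩ := mem_tangentConeAt_iff_exists_seq.1 (g i).2
        exact mem_tangentConeAt_iff_exists_seq.2 ⟨fun k => a i * c k, d, h₁, h₂, by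
          simpa [mul_smul] using h₃.const_smul (a i)⟩
    · rintro ⟨N, m, v, ⟨-, hv⟩, h⟩
      refine le_trans ?_ hv
      rw [Submodule.starProjection_minimal]
      exact ciInf_le ⟨0, by rintro _ ⟨_, rfl⟩; exact norm_nonneg _⟩
        (⟨∑ i, v i, Submodule.sum_mem _ fun i _ => Submodule.subset_span (h i)⟩ :
          Submodule.span ℝ (tangentConeAt ℝ S (x : E)))
  rw [hset]
  exact MeasurableSet.iUnion fun N => MeasurableSet.iUnion fun m =>
    measurableSet_exists_mem_tangentConeAt hS ((isCompact_closedBall _ _).inter_right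
      (isClosed_le (by fun_prop) continuous_const))

/-- Pythagoras recovers `⟪P u, u⟫` from the distance to the span, and polarization of the symmetric
`P` gives all its matrix entries. -/
theorem measurable_starProjection_tangentSpan {S : Set E} (hS : IsCompact S) (w : E) :
    Measurable fun x : S => (Submodule.span ℝ (tangentConeAt ℝ S (x : E))).starProjection w := by
  let P : S → E →L[ℝ] E := fun x => (Submodule.span ℝ (tangentConeAt ℝ S (x : E))).starProjection
  have hsymm : ∀ x u v, ⟪P x u, v⟫_ℝ = ⟪u, P x v⟫_ℝ := fun x u v =>
    Submodule.inner_starProjection_left_eq_right _ u v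
  have hself : ∀ u, Measurable fun x => ⟪P x u, u⟫_ℝ := by
    intro u
    have h : ∀ x, ⟪P x u, u⟫_ℝ = ‖u‖ ^ 2 - ‖u - P x u‖ ^ 2 := by
      intro x
      have h₀ : ⟪P x u, P x u⟫_ℝ = ⟪P x u, u⟫_ℝ := by
        have := Submodule.starProjection_inner_eq_zero u (P x u)
          ((Submodule.span ℝ (tangentConeAt ℝ S (x : E))).starProjection_apply_mem u)
        rw [inner_sub_left, sub_eq_zero, real_inner_comm] at this
        exact this.symm
      rw [norm_sub_sq_real, ← real_inner_self_eq_norm_sq (P x u), h₀, real_inner_comm]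
      ring
    simp_rw [h]
    exact measurable_const.sub ((measurable_norm_sub_starProjection_tangentSpan hS u).pow_const 2)
  have hinner : ∀ u v, Measurable fun x => ⟪P x u, v⟫_ℝ := by
    intro u v
    have h : ∀ x, ⟪P x u, v⟫_ℝ = (⟪P x (u + v), u + v⟫_ℝ - ⟪P x u, u⟫_ℝ - ⟪P x v, v⟫_ℝ) / 2 := by
      intro x
      simp only [map_add, inner_add_left, inner_add_right]
      rw [hsymm x v u, real_inner_comm v]
      ring
    simp_rw [h]
    exact (((hself _).sub (hself _)).sub (hself _)).div_const 2
  let b := stdOrthonormalBasis ℝ E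
  have h : (fun x => P x w) = fun x => ∑ i, ⟪P x (b i), w⟫_ℝ • b i := funext fun x => by
    simp only [hsymm]
    exact (b.sum_repr' (P x w)).symm
  change Measurable fun x => P x w
  rw [h]
  exact Finset.measurable_sum _ fun i _ => (hinner (b i) w).smul_const (b i)

end TangentMeasurability

/-! ### Measurability of the tangential Jacobian. -/

section JacobianMeasurability

variable {n : ℕ}

theorem measurable_tangentialJacobian {S : Set (EuclideanSpace ℝ (Fin n))} (hS : IsCompact S)
    {f : EuclideanSpace ℝ (Fin n) → EuclideanSpace ℝ (Fin n)} (hf : ContDiff ℝ 1 f) :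
    Measurable fun x : S => tangentialJacobian S f x := by
  have h : ∀ x : S, tangentialJacobian S f x = √(Matrix.of fun i j =>
      inner ℝ (EuclideanSpace.basisFun (Fin n) ℝ i) (EuclideanSpace.basisFun (Fin n) ℝ j) +
      (inner ℝ (fderiv ℝ f x ((Submodule.span ℝ (tangentConeAt ℝ S (x : EuclideanSpace ℝ (Fin n)))
          ).starProjection (EuclideanSpace.basisFun (Fin n) ℝ i)))
        (fderiv ℝ f x (EuclideanSpace.basisFun (Fin n) ℝ j)) -
      inner ℝ ((Submodule.span ℝ (tangentConeAt ℝ S (x : EuclideanSpace ℝ (Fin n)))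
          ).starProjection (EuclideanSpace.basisFun (Fin n) ℝ i))
        (EuclideanSpace.basisFun (Fin n) ℝ j))).det := by
    intro x
    rw [tangentialJacobian, tangentialDeriv_eq
      ((hf.differentiable one_ne_zero).differentiableAt.hasFDerivAt.hasFDerivWithinAt),
      det_adjoint_comp_domRestrict (EuclideanSpace.basisFun (Fin n) ℝ)]
    rfl
  simp_rw [h]
  refine Measurable.sqrt ?_
  have hD : Continuous (fderiv ℝ f) := hf.continuous_fderiv one_ne_zero
  simp_rw [Matrix.det_apply]
  refine Finset.measurable_sum _ fun σ _ => Measurable.const_smul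
    (Finset.measurable_prod _ fun i _ => ?_) _
  simp only [Matrix.of_apply]
  refine measurable_const.add (Measurable.sub (Measurable.inner ?_ ?_) (Measurable.inner ?_ ?_))
  · exact (isBoundedBilinearMap_apply.continuous.measurable).comp
      ((hD.measurable.comp measurable_subtype_coe).prodMk
        (measurable_starProjection_tangentSpan hS _))
  · exact ((hD.clm_apply continuous_const).measurable).comp measurable_subtype_coe
  · exact measurable_starProjection_tangentSpan hS _
  · exact measurable_const

end JacobianMeasurability

/-! ### Finiteness of the surface measure. -/

section SurfaceMeasure

open scoped ENNReal

variable {n : ℕ}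

theorem AntilipschitzWith.euclideanHausdorffMeasure_image_ge {X Y : Type*} [MetricSpace X]
    [MeasurableSpace X] [BorelSpace X] [MetricSpace Y] [MeasurableSpace Y] [BorelSpace Y]
    {f : X → Y} {K : ℝ≥0} (hf : AntilipschitzWith K f) (d : ℕ) (s : Set X) :
    Measure.euclideanHausdorffMeasure d s ≤
      (K : ℝ≥0∞) ^ (d : ℝ) * Measure.euclideanHausdorffMeasure d (f '' s) := by
  simp_rw [Measure.euclideanHausdorffMeasure_def, Measure.smul_apply, Measure.nnreal_smul_coe_apply]
  rw [mul_left_comm]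
  gcongr
  exact hf.le_hausdorffMeasure_image d.cast_nonneg s

theorem norm_le_norm_dropLast_add (v : EuclideanSpace ℝ (Fin (n + 1))) :
    ‖v‖ ≤ ‖dropLast v‖ + |v (Fin.last n)| := by
  have h : ‖v‖ ^ 2 = ‖dropLast v‖ ^ 2 + |v (Fin.last n)| ^ 2 := by
    rw [EuclideanSpace.norm_sq_eq, EuclideanSpace.norm_sq_eq, Fin.sum_univ_castSucc]
    rfl
  refine abs_le_of_sq_le_sq' ?_ (by positivity) |>.2
  nlinarith [mul_nonneg (norm_nonneg (dropLast v)) (abs_nonneg (v (Fin.last n)))]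

/-- Near `x` the frontier lies on the graph of `γ`, where dropping the last coordinate is
antilipschitz with constant `1 + K`; the measure is thus controlled by the Lebesgue measure of a
bounded set. -/
theorem HasLipschitzBoundary.finiteAtFilter {U : Set (EuclideanSpace ℝ (Fin (n + 1)))}
    (hUo : IsOpen U) (hU : HasLipschitzBoundary U) {x : EuclideanSpace ℝ (Fin (n + 1))}
    (hx : x ∈ frontier U) :
    (Measure.euclideanHausdorffMeasure n : Measure (EuclideanSpace ℝ (Fin (n + 1)))).FiniteAtFilter
      (𝓝[frontier U] x) := by
  obtain ⟨R, r, γ, hr, ⟨K, hK⟩, h⟩ := hU x hx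
  change ∀ y, (∀ i, |R y i - R x i| ≤ r) → (y ∈ U ↔ γ (dropLast (R y)) < R y (Fin.last n)) at h
  let S : Set (EuclideanSpace ℝ (Fin (n + 1))) :=
    ({y | ∀ i, |R y i - R x i| < r} ∩ Metric.ball x 1) ∩ frontier U
  have hS : S ∈ 𝓝[frontier U] x := by
    refine inter_mem (mem_nhdsWithin_of_mem_nhds (inter_mem ?_ (Metric.ball_mem_nhds x one_pos)))
      self_mem_nhdsWithin
    exact eventually_abs_apply_sub_lt R x hr
  have hgraph : ∀ y ∈ S, γ (dropLast (R y)) = R y (Fin.last n) := by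
    rintro y ⟨⟨hy₁, -⟩, hy⟩
    refine le_antisymm
      (graph_le_of_mem_closure hK.continuous h (frontier_subset_closure hy) hy₁) ?_
    rw [hUo.frontier_eq] at hy
    have := hy.2
    rwa [h y fun i => (hy₁ i).le, not_lt] at this
  have hanti : AntilipschitzWith (1 + K) fun y : S => dropLast (R (y : EuclideanSpace ℝ _)) := by
    refine AntilipschitzWith.of_le_mul_dist fun y z => ?_
    have h₁ := norm_le_norm_dropLast_add (R y - R z)
    have h₂ := hK.dist_le_mul (dropLast (R y)) (dropLast (R z))
    rw [hgraph y y.2, hgraph z z.2, Real.dist_eq] at h₂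
    rw [← map_sub, R.norm_map, map_sub, map_sub, ← dist_eq_norm, ← dist_eq_norm,
      PiLp.sub_apply] at h₁
    rw [Subtype.dist_eq, NNReal.coe_add, NNReal.coe_one]
    linarith
  refine ⟨S, hS, ?_⟩
  have hbdd : Bornology.IsBounded
      ((fun y : S => dropLast (R (y : EuclideanSpace ℝ (Fin (n + 1))))) '' univ) := by
    have hlip := ((dropLast (n := n)).comp R.toContinuousLinearEquiv.toContinuousLinearMap).lipschitz
    refine (hlip.isBounded_image (Metric.isBounded_ball (x := x) (r := 1))).subset ?_
    rintro _ ⟨y, -, rfl⟩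
    exact ⟨y, y.2.1.2, rfl⟩
  have himage := isometry_subtype_coe (s := S).euclideanHausdorffMeasure_image (d := n) univ
  rw [image_univ, Subtype.range_coe] at himage
  rw [himage]
  refine (hanti.euclideanHausdorffMeasure_image_ge n univ).trans_lt ?_
  rw [EuclideanSpace.euclideanHausdorffMeasure_eq_volume]
  exact ENNReal.mul_lt_top (ENNReal.rpow_lt_top_of_nonneg n.cast_nonneg ENNReal.coe_ne_top)
    hbdd.measure_lt_top

theorem HasLipschitzBoundary.isFiniteMeasure_surfaceMeasure
    {U : Set (EuclideanSpace ℝ (Fin (n + 1)))} (hUo : IsOpen U) (hb : Bornology.IsBounded U)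
    (hU : HasLipschitzBoundary U) : IsFiniteMeasure (surfaceMeasure U) := by
  refine ⟨?_⟩
  rw [surfaceMeasure, Measure.restrict_apply_univ]
  have hc : IsCompact (frontier U) :=
    hb.isCompact_closure.of_isClosed_subset isClosed_frontier frontier_subset_closure
  exact hc.measure_lt_top_of_nhdsWithin fun x hx => hU.finiteAtFilter hUo hx

end SurfaceMeasure

/-! ### Construction of the deformation and conclusion. -/

/-- Every upper bound holds strictly at `ε = 0` and is continuous in `ε`. After positivity they
serve inwardness of the steps, invertibility, invariance of `U`, and separation of near and of far
points. -/
theorem exists_displacement_size {δ : ℝ} (hδ : 0 < δ) (L M : ℝ) :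
    ∃ ε : ℝ, 0 < ε ∧ ε ≤ δ ∧ ε * L < 1 ∧ ε * M * (L + 1) < δ ∧ 2 * (ε * L * (δ + M)) ≤ δ ∧
      4 * (ε * M) ≤ δ := by
  have key : ∀ (f : ℝ → ℝ) (a : ℝ), Continuous f → f 0 = 0 → 0 < a → ∀ᶠ ε in 𝓝[>] (0 : ℝ), f ε < a :=
    fun f a hf h0 ha => nhdsWithin_le_nhds (hf.continuousAt.eventually_lt_const (by rwa [h0]))
  have h₀ : ∀ᶠ ε in 𝓝[>] (0 : ℝ), 0 < ε := eventually_mem_nhdsWithin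
  obtain ⟨ε, e₀, e₁, e₂, e₃, e₄, e₅⟩ := (h₀.and ((key id δ continuous_id rfl hδ).and
    ((key (fun ε => ε * L) 1 (by fun_prop) (by simp) one_pos).and
    ((key (fun ε => ε * M * (L + 1)) δ (by fun_prop) (by simp) hδ).and
    ((key (fun ε => 2 * (ε * L * (δ + M))) δ (by fun_prop) (by simp) hδ).and
    (key (fun ε => 4 * (ε * M)) δ (by fun_prop) (by simp) hδ)))))).exists
  exact ⟨ε, e₀, le_of_lt e₁, e₂, e₃, e₄.le, e₅.le⟩

section Deformation

variable {n : ℕ} {U : Set (EuclideanSpace ℝ (Fin (n + 1)))}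
  {W : EuclideanSpace ℝ (Fin (n + 1)) → EuclideanSpace ℝ (Fin (n + 1))}

theorem isLipschitzDeformation_of_inward (hU : IsOpen U) {δ : ℝ} (hδ : 0 < δ)
    (h : ∀ x ∈ frontier U, ∀ z ∈ closure U, ‖z - x‖ < δ → ∀ w, ‖w - W x‖ < δ →
      ∀ t ∈ Ioc (0 : ℝ) δ, z + t • w ∈ U)
    {L : ℝ≥0} (hW : LipschitzWith L W) {M : ℝ} (hM : ∀ x, ‖W x‖ ≤ M) {ε : ℝ} (hε₀ : 0 < ε)
    (hε : ε ≤ δ) (hε₁ : ε * L < 1) (hεM : ε * M * (L + 1) < δ) (hεL : 2 * (ε * L * (δ + M)) ≤ δ)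
    (hεM' : 4 * (ε * M) ≤ δ) :
    IsLipschitzDeformation U fun p => p.1 + (ε * p.2) • W p.1 := by
  have hM₀ : 0 ≤ M := (norm_nonneg _).trans (hM 0)
  have hL₀ : (0 : ℝ) ≤ L := L.2
  have hUU : ∀ τ ∈ Ioc (0 : ℝ) 1, MapsTo (fun x => x + (ε * τ) • W x) U U := fun τ hτ => by
    have hετ : ε * τ ≤ ε := mul_le_of_le_one_right hε₀.le hτ.2
    refine mapsTo_add_smul_of_inward hδ h hW hM ⟨mul_pos hε₀ hτ.1, hετ.trans hε⟩ (lt_of_le_of_lt ?_ hεM)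
    gcongr
  have hcont : ∀ t : ℝ, Continuous fun x => x + t • W x := fun t =>
    continuous_id.add (hW.continuous.const_smul t)
  refine ⟨?_, ?_, ?_, fun x _ => by simp, ?_⟩
  · rintro ⟨x, τ⟩ ⟨hx, hτ⟩
    rcases hτ.1.eq_or_lt with h0 | h0
    · simp only at h0
      simpa [← h0] using frontier_subset_closure hx
    · exact ((hUU τ ⟨h0, hτ.2⟩).closure (hcont _)) (frontier_subset_closure hx)
  · have hc : 0 ≤ 1 + ε * L + ε * M := by positivity
    refine ⟨⟨1 + ε * L + ε * M, hc⟩, LipschitzOnWith.of_dist_le_mul ?_⟩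
    rintro ⟨x, s⟩ ⟨hx, hs⟩ ⟨y, t⟩ ⟨hy, ht⟩
    have d₁ : ‖x - y‖ ≤ dist (x, s) (y, t) := by
      rw [← dist_eq_norm]
      exact le_max_left _ _
    have d₂ : |s - t| ≤ dist (x, s) (y, t) := by
      rw [← Real.dist_eq]
      exact le_max_right _ _
    have n₁ : ‖(ε * s) • (W x - W y)‖ ≤ ε * L * dist (x, s) (y, t) := by
      rw [norm_smul, Real.norm_of_nonneg (mul_nonneg hε₀.le hs.1), mul_assoc]
      have w₁ : ‖W x - W y‖ ≤ L * dist (x, s) (y, t) := by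
        rw [← dist_eq_norm]
        exact (hW.dist_le_mul x y).trans (mul_le_mul_of_nonneg_left (le_max_left _ _) hL₀)
      calc ε * (s * ‖W x - W y‖) ≤ ε * (1 * (L * dist (x, s) (y, t))) := by
            gcongr
            exact hs.2
        _ = ε * L * dist (x, s) (y, t) := by ring
    have n₂ : ‖(ε * (s - t)) • W y‖ ≤ ε * M * dist (x, s) (y, t) := by
      rw [norm_smul, Real.norm_eq_abs, abs_mul, abs_of_pos hε₀]
      calc ε * |s - t| * ‖W y‖ ≤ ε * dist (x, s) (y, t) * M := by
            gcongr
            exact hM y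
        _ = ε * M * dist (x, s) (y, t) := by ring
    have e : x + (ε * s) • W x - (y + (ε * t) • W y) =
        (x - y) + (ε * s) • (W x - W y) + (ε * (s - t)) • W y := by module
    change dist (x + (ε * s) • W x) (y + (ε * t) • W y) ≤
      (1 + ε * L + ε * M) * dist (x, s) (y, t)
    rw [dist_eq_norm, e]
    have := norm_add₃_le (a := x - y) (b := (ε * s) • (W x - W y)) (c := (ε * (s - t)) • W y)
    linarith
  · obtain ⟨K, hK⟩ := exists_sub_le_mul_norm_of_inward hU hδ h hW hM hε hεL hεM'
    -- The displacement times are `ε * s` and `ε * t`, so recovering `|s - t|` costs a factor `1 /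
    -- ε`.
    refine ⟨Real.toNNReal (max K (K / ε)), AntilipschitzWith.of_le_mul_dist ?_⟩
    rintro ⟨⟨x, s⟩, hx, hs⟩ ⟨⟨y, t⟩, hy, ht⟩
    have hmem : ∀ s ∈ Icc (0 : ℝ) 1, ε * s ∈ Icc 0 ε := fun s hs =>
      ⟨mul_nonneg hε₀.le hs.1, mul_le_of_le_one_right hε₀.le hs.2⟩
    obtain ⟨k₁, k₂⟩ := hK x hx y hy _ (hmem s hs) _ (hmem t ht)
    change max (dist x y) (dist s t) ≤
      _ * dist (x + (ε * s) • W x) (y + (ε * t) • W y)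
    rw [dist_eq_norm (x + _)]
    set N := ‖x + (ε * s) • W x - (y + (ε * t) • W y)‖
    have hN : 0 ≤ N := norm_nonneg _
    refine le_trans ?_ (mul_le_mul_of_nonneg_right (Real.le_coe_toNNReal _) hN)
    refine max_le ?_ ?_
    · rw [dist_eq_norm]
      exact k₁.trans (mul_le_mul_of_nonneg_right (le_max_left _ _) hN)
    · refine le_trans ?_ (mul_le_mul_of_nonneg_right (le_max_right _ _) hN)
      rw [← mul_sub, abs_mul, abs_of_pos hε₀] at k₂
      rw [Real.dist_eq, div_mul_eq_mul_div, le_div_iff₀ hε₀]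
      linarith
  · intro τ hτ
    obtain ⟨Φ, hΦ⟩ := exists_homeomorph_add_smul hW (mul_nonneg hε₀.le hτ.1.le) (t := ε * τ)
      (lt_of_le_of_lt (mul_le_mul_of_nonneg_right (mul_le_of_le_one_right hε₀.le hτ.2) hL₀) hε₁)
    have hΦ' : (fun x => x + (ε * τ) • W x) = Φ := funext fun x => (hΦ x).symm
    refine ⟨Φ '' U, Φ.isOpenMap U hU, ?_, ?_⟩
    · rw [← hΦ']
      exact (hUU τ hτ).image_subset
    · simp only [hΦ']
      exact (Φ.image_frontier U).symm

/-- The displacement along a `C¹` field has tangential Jacobian uniformly close to `1`. -/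
theorem tangentialJacobian_add_smul_mem_Icc (hC : ContDiff ℝ 1 W) {L : ℝ≥0}
    (hW : LipschitzWith L W) {t : ℝ} (ht₀ : 0 ≤ t) (ht : t * L ≤ 1)
    (S : Set (EuclideanSpace ℝ (Fin (n + 1)))) (x : EuclideanSpace ℝ (Fin (n + 1))) :
    tangentialJacobian S (fun x => x + t • W x) x ∈
      Icc ((1 - t * L) ^ (n + 1)) ((1 + t * L) ^ (n + 1)) := by
  have hd : HasFDerivAt W (fderiv ℝ W x) x :=
    (hC.differentiable one_ne_zero).differentiableAt.hasFDerivAt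
  refine tangentialJacobian_mem_Icc
    (((hasFDerivAt_id x).add (hd.const_smul t)).hasFDerivWithinAt) ?_ ht
  rw [norm_smul, Real.norm_of_nonneg ht₀]
  exact mul_le_mul_of_nonneg_left (norm_fderiv_le_of_lipschitz ℝ hW) ht₀

end Deformation

theorem mainTheorem9 {n : ℕ} (U : Set (EuclideanSpace ℝ (Fin (n + 1))))
    (hU : IsOpen U) (hUb : Bornology.IsBounded U) (hLip : HasLipschitzBoundary U) :
    ∃ Ψ : EuclideanSpace ℝ (Fin (n + 1)) × ℝ → EuclideanSpace ℝ (Fin (n + 1)),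
      IsRegularLipschitzDeformation U Ψ := by
  obtain ⟨W, hC, hsupp, hin⟩ := hLip.exists_vectorField hUb
  obtain ⟨L, hL⟩ := ContDiff.lipschitzWith_of_hasCompactSupport hsupp hC one_ne_zero
  obtain ⟨M, hM⟩ := hsupp.exists_bound_of_continuous hC.continuous
  have hc : IsCompact (frontier U) :=
    hUb.isCompact_closure.of_isClosed_subset isClosed_frontier frontier_subset_closure
  obtain ⟨δ, hδ, h⟩ := exists_uniform_inward hc hC.continuous hin
  obtain ⟨ε, hε₀, hε, hε₁, hεM, hεL, hεM'⟩ := exists_displacement_size hδ L M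
  have hfin := hLip.isFiniteMeasure_surfaceMeasure hU hUb
  have hC' : ∀ t : ℝ, ContDiff ℝ 1 fun x => x + t • W x := fun t => contDiff_id.add (hC.const_smul t)
  have hJ : ∀ τ ∈ Ioc (0 : ℝ) 1, ∀ x,
      tangentialJacobian (frontier U) (fun x => x + (ε * τ) • W x) x ∈
        Icc ((1 - ε * τ * L) ^ (n + 1)) ((1 + ε * τ * L) ^ (n + 1)) := fun τ hτ x => by
    refine tangentialJacobian_add_smul_mem_Icc hC hL (mul_nonneg hε₀.le hτ.1.le)
      (le_trans ?_ hε₁.le) _ x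
    exact mul_le_mul_of_nonneg_right (mul_le_of_le_one_right hε₀.le hτ.2) L.2
  refine ⟨fun p => p.1 + (ε * p.2) • W p.1, ⟨isLipschitzDeformation_of_inward hU hδ h hL hM hε₀ hε
    hε₁ hεM hεL hεM', ?_, ?_, ?_⟩⟩
  · exact fun τ _ => Eventually.of_forall fun x =>
      ((hC' (ε * τ)).differentiable one_ne_zero).differentiableAt.differentiableWithinAt
  · intro τ hτ
    refine Integrable.of_bound (aemeasurable_restrict_of_measurable_subtype
      isClosed_frontier.measurableSet
      (measurable_tangentialJacobian hc (hC' (ε * τ)))).aestronglyMeasurable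
      ((1 + ε * τ * L) ^ (n + 1)) (Eventually.of_forall fun x => ?_)
    exact (Real.norm_of_nonneg (Real.sqrt_nonneg _)).trans_le (hJ τ hτ x).2
  -- Both `1` and the Jacobian lie in an interval of length `b τ`, so `|J - 1| ≤ b τ` everywhere;
  -- finiteness of the measure turns this into an `L¹` bound.
  · set b : ℝ → ℝ := fun τ => (1 + ε * τ * L) ^ (n + 1) - (1 - ε * τ * L) ^ (n + 1) with hb
    have hbt : Tendsto (fun τ => surfaceMeasure U univ ^ (1 : ENNReal).toReal⁻¹ *
        ENNReal.ofReal (b τ)) (𝓝[>] 0) (𝓝 0) := by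
      have hbc : Continuous b := by fun_prop
      have hb0 : Tendsto b (𝓝[>] 0) (𝓝 0) := by
        have := hbc.tendsto 0
        simp only [hb, mul_zero, zero_mul, add_zero, sub_zero, one_pow, sub_self] at this
        exact this.mono_left nhdsWithin_le_nhds
      have := ENNReal.Tendsto.const_mul (ENNReal.tendsto_ofReal hb0) (Or.inr
        (ENNReal.rpow_ne_top_of_nonneg (y := (1 : ENNReal).toReal⁻¹) (by simp)
          (measure_ne_top (surfaceMeasure U) univ)))
      simpa using this
    refine tendsto_of_tendsto_of_tendsto_of_le_of_le' tendsto_const_nhds hbt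
      (Eventually.of_forall fun _ => zero_le) ?_
    filter_upwards [Ioc_mem_nhdsGT (zero_lt_one' ℝ)] with τ hτ
    refine eLpNorm_le_of_ae_bound (Eventually.of_forall fun x => ?_)
    have hτL : 0 ≤ ε * τ * L := mul_nonneg (mul_nonneg hε₀.le hτ.1.le) L.2
    have hτL' : ε * τ * L ≤ 1 :=
      (mul_le_mul_of_nonneg_right (mul_le_of_le_one_right hε₀.le hτ.2) L.2).trans hε₁.le
    have l₁ : 1 ≤ (1 + ε * τ * L) ^ (n + 1) := one_le_pow₀ (by linarith)
    have l₂ : (1 - ε * τ * L) ^ (n + 1) ≤ 1 := pow_le_one₀ (by linarith) (by linarith)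
    have := hJ τ hτ x
    rw [Real.norm_eq_abs, abs_le]
    exact ⟨by linarith [this.1], by linarith [this.2]⟩
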